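/- A tournament is a loopless digraph such that for any two distinct vertices $v,w$ exactly one of $(v,w)$, $(w,v)$ is an edge; $v$ is adjacent to $w$ if $(v,w)$ is an edge. A tournament is transitive if it contains no directed cycle, and $H$-free if it has no subtournament isomorphic to $H$. Let $C_5$ be the tournament on $\{0,1,2,3,4\}$ in which each $i$ is adjacent exactly to $i+1$ and $i+2$ modulo $5$ (up to isomorphism, the unique five-vertex tournament in which every vertex has exactly two outneighbors and two inneighbors). Let $L_1$ be the six-vertex tournament obtained from $C_5$ by adding one new vertex that is adjacent to exactly one vertex of $C_5$, the other four vertices of $C_5$ being adjacent to the new vertex (up to isomorphism the choice of that one vertex does not matter). \textbf{Theorem.} The tournament $L_1$ has the Erd\H{o}s--Hajnal property: there exists $\epsilon>0$ such that for every $n$, every $L_1$-free tournament on $n$ vertices contains a transitive subtournament with at least $n^{\epsilon}$ vertices. -/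

import Mathlib

namespace Digraph

/-- A tournament: a digraph without loops such that for any two distinct vertices `v`, `w` exactly
one of the edges `(v, w)`, `(w, v)` is present. `G.Adj v w` reads "`v` is adjacent to `w`", that
is, `(v, w)` is an edge, directed from `v` to `w`. -/
structure IsTournament {V : Type*} (G : Digraph V) : Prop where
  loopless : ∀ v, ¬ G.Adj v v
  xor_adj : ∀ v w, v ≠ w → Xor (G.Adj v w) (G.Adj w v)

/-- `G.HasCycleIn S`: the subdigraph of `G` induced by `S` contains a directed cycle
`c 0 → c 1 → ⋯ → c k → c 0` on distinct vertices (addition in `Fin (k + 1)` is cyclic). -/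
def HasCycleIn {V : Type*} (G : Digraph V) (S : Set V) : Prop :=
  ∃ (k : ℕ) (c : Fin (k + 1) → V), Function.Injective c ∧ (∀ i, c i ∈ S) ∧
    ∀ i, G.Adj (c i) (c (i + 1))

/-- The vertex set `S` induces a transitive subtournament of the tournament `G`: there is no
directed cycle inside `S`. -/
def IsTransitiveOn {V : Type*} (G : Digraph V) (S : Set V) : Prop :=
  ¬ G.HasCycleIn S

/-- `T` is `H`-free: no set of vertices of `T` induces a copy of `H`. -/
def IsFree {V W : Type*} (T : Digraph V) (H : Digraph W) : Prop :=
  IsEmpty (H.Adj ↪r T.Adj)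

/-- The Erdős–Hajnal property of a tournament `H`: for some `ε > 0`, every finite `H`-free
tournament on `n` vertices has a transitive subtournament on at least `n ^ ε` vertices. -/
def HasErdosHajnalProperty {W : Type*} (H : Digraph W) : Prop :=
  ∃ ε : ℝ, 0 < ε ∧ ∀ (V : Type) [Fintype V] (T : Digraph V), T.IsTournament → T.IsFree H →
    ∃ S : Finset V, T.IsTransitiveOn (S : Set V) ∧ (Fintype.card V : ℝ) ^ ε ≤ (S.card : ℝ)

/-- The tournament `C₅`: the vertices are `0, …, 4`, and `i` is adjacent to `i + 1` and `i + 2`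
modulo `5`. -/
def C5 : Digraph (Fin 5) where
  Adj i j := j = i + 1 ∨ j = i + 2

/-- The tournament `L₁`: one extra vertex `none` is added to `C₅`, which is adjacent to exactly one
vertex of `C₅` (the vertex `0`), while the other four vertices of `C₅` are adjacent to it. -/
def L1 : Digraph (Option (Fin 5)) where
  Adj
    | some i, some j => C5.Adj i j
    | none, some j => j = 0
    | some i, none => i ≠ 0
    | none, none => False

instance : DecidableRel C5.Adj := fun i j => inferInstanceAs (Decidable (j = i + 1 ∨ j = i + 2))

instance : DecidableRel L1.Adj
  | some i, some j => inferInstanceAs (Decidable (C5.Adj i j))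
  | none, some j => inferInstanceAs (Decidable (j = 0))
  | some i, none => inferInstanceAs (Decidable (i ≠ 0))
  | none, none => inferInstanceAs (Decidable False)

theorem C5_isTournament : C5.IsTournament :=
  ⟨by decide, by unfold Xor; decide⟩

/-- Every vertex of `C₅` has exactly two outneighbors and exactly two inneighbors. -/
theorem C5_regular (v : Fin 5) :
    (Finset.univ.filter fun w => C5.Adj v w).card = 2 ∧
      (Finset.univ.filter fun w => C5.Adj w v).card = 2 := by
  revert v; decide

theorem L1_isTournament : L1.IsTournament :=
  ⟨by decide, by unfold Xor; decide⟩

end Digraph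

/-! Let `S` be an inclusion-minimal counterexample and `N = |S| ^ ε`. Then `S` has no transitive
subset of size `N`, but for small `ε` every proper subset of linear size has one of size at least
`7N/8`. So of two disjoint linear sets neither is complete to the other: their transitive subsets
would combine (`exists_adj_of_large`).

Excluding `L1` gives six linear sets in a row with almost all edges between them forward
(`exists_smooth_seq`). Set number 2 is replaced by a transitive set of size `7N/8`. A few
well-chosen backward edges, together with the abundance of forward edges, then form a copy of `C5`,
and block 4 supplies the sixth vertex: the only copy vertex in block 5 is its outneighbor, and all
the others come from earlier blocks (`not_isFree_L1_of_structure`). -/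

namespace Digraph

section

universe u

open Finset
open scoped Classical

variable {V : Type*} {T : Digraph V}

/-! ### Transitive vertex sets. -/

/-- Adjacency is a transitive relation on the finite vertex set `X`. -/
def TransOn (T : Digraph V) (X : Finset V) : Prop :=
  ∀ a ∈ X, ∀ b ∈ X, ∀ c ∈ X, T.Adj a b → T.Adj b c → T.Adj a c

/-- `X` and `Y` are disjoint, and every vertex of either set is incident with few edges
directed from `Y` to `X`. -/
def Smooth (T : Digraph V) (r : ℝ) (X Y : Finset V) : Prop :=
  Disjoint X Y ∧ (∀ x ∈ X, (#{y ∈ Y | T.Adj y x} : ℝ) ≤ r * #Y) ∧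
    ∀ y ∈ Y, (#{x ∈ X | T.Adj y x} : ℝ) ≤ r * #X

theorem IsTournament.asymm (hT : T.IsTournament) {v w : V} (h : T.Adj v w) : ¬ T.Adj w v := by
  intro h'
  by_cases e : v = w
  · subst e; exact hT.loopless _ h
  · rcases hT.xor_adj v w e with h1 | h1
    · exact h1.2 h'
    · exact h1.2 h

theorem IsTournament.adj_of_not (hT : T.IsTournament) {v w : V} (e : v ≠ w) (h : ¬ T.Adj v w) :
    T.Adj w v := by
  rcases hT.xor_adj v w e with h1 | h1
  · exact absurd h1.1 h
  · exact h1.1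

theorem TransOn.mono {X Y : Finset V} (h : T.TransOn Y) (hXY : X ⊆ Y) : T.TransOn X :=
  fun a ha b hb c hc => h a (hXY ha) b (hXY hb) c (hXY hc)

theorem TransOn.isTransitiveOn (hT : T.IsTournament) {X : Finset V} (h : T.TransOn X) :
    T.IsTransitiveOn (X : Set V) := by
  rintro ⟨k, c, -, hc, hadj⟩
  have key : ∀ m : ℕ, (hm : m < k + 1) → m ≠ 0 → T.Adj (c 0) (c ⟨m, hm⟩) := by
    intro m
    induction m with
    | zero => intro _ h0; exact absurd rfl h0
    | succ m ih =>
      intro hm _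
      have e : (⟨m, by omega⟩ : Fin (k + 1)) + 1 = ⟨m + 1, hm⟩ := by
        apply Fin.ext
        simp [Fin.val_add, Nat.mod_eq_of_lt hm]
      have h1 := hadj ⟨m, by omega⟩
      rw [e] at h1
      by_cases h0 : m = 0
      · subst h0; exact h1
      · exact h _ (hc _) _ (hc _) _ (hc _) (ih (by omega) h0) h1
  have hlast := hadj (Fin.last k)
  rw [Fin.last_add_one] at hlast
  by_cases hk : k = 0
  · subst hk
    exact hT.loopless _ hlast
  · exact hT.asymm hlast (key k (Nat.lt_succ_self k) hk)

theorem TransOn.union (hT : T.IsTournament) {X Y : Finset V} (hX : T.TransOn X)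
    (hY : T.TransOn Y) (hXY : ∀ x ∈ X, ∀ y ∈ Y, T.Adj x y) : T.TransOn (X ∪ Y) := by
  intro a ha b hb c hc hab hbc
  rw [mem_union] at ha hb hc
  rcases ha with ha | ha <;> rcases hb with hb | hb <;> rcases hc with hc | hc
  · exact hX a ha b hb c hc hab hbc
  · exact hXY a ha c hc
  · exact absurd hbc (hT.asymm (hXY c hc b hb))
  · exact hXY a ha c hc
  · exact absurd hab (hT.asymm (hXY b hb a ha))
  · exact absurd hab (hT.asymm (hXY b hb a ha))
  · exact absurd hbc (hT.asymm (hXY c hc b hb))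
  · exact hY a ha b hb c hc hab hbc

theorem TransOn.singleton (hT : T.IsTournament) (v : V) : T.TransOn {v} := by
  intro a ha b hb c hc hab hbc
  rw [mem_singleton] at ha hb
  subst ha; subst hb
  exact absurd hab (hT.loopless _)

/-- A tournament on `2 ^ k` vertices has a transitive subtournament on `k + 1` vertices. -/
theorem IsTournament.exists_transOn_of_two_pow_le (hT : T.IsTournament) (k : ℕ) :
    ∀ S : Finset V, 2 ^ k ≤ #S → ∃ X ⊆ S, T.TransOn X ∧ k + 1 ≤ #X := by
  induction k with
  | zero =>
    intro S hS
    obtain ⟨v, hv⟩ := card_pos.1 (lt_of_lt_of_le (by norm_num) hS)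
    exact ⟨{v}, by simpa using hv, .singleton hT v, by simp⟩
  | succ k ih =>
    intro S hS
    obtain ⟨v, hv⟩ := card_pos.1 (lt_of_lt_of_le (by positivity) hS)
    have hcard : #S ≤ #{w ∈ S | T.Adj v w} + #{w ∈ S | T.Adj w v} + 1 := by
      have : S ⊆ ({w ∈ S | T.Adj v w} ∪ {w ∈ S | T.Adj w v}) ∪ {v} := by
        intro w hw
        by_cases e : w = v
        · simp [e]
        · by_cases h : T.Adj w v
          · simp [hw, h]
          · simp [hw, hT.adj_of_not e h]
      refine (card_le_card this).trans ((card_union_le _ _).trans ?_)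
      have := card_union_le {w ∈ S | T.Adj v w} {w ∈ S | T.Adj w v}
      simp only [card_singleton]
      omega
    rw [pow_succ] at hS
    rcases le_or_gt (2 ^ k) #{w ∈ S | T.Adj v w} with h | h
    · obtain ⟨X, hX, hX1, hX2⟩ := ih _ h
      have hv' : v ∉ X := fun hx => hT.loopless v (mem_filter.1 (hX hx)).2
      refine ⟨{v} ∪ X, ?_, ?_, ?_⟩
      · exact union_subset (by simpa using hv) (hX.trans (filter_subset _ _))
      · refine .union hT (.singleton hT v) hX1 fun x hx y hy => ?_
        rw [mem_singleton] at hx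
        subst hx
        exact (mem_filter.1 (hX hy)).2
      · rw [card_union_of_disjoint (by simpa using hv')]
        simp; omega
    · obtain ⟨X, hX, hX1, hX2⟩ := ih {w ∈ S | T.Adj w v} (by omega)
      have hv' : v ∉ X := fun hx => hT.loopless v (mem_filter.1 (hX hx)).2
      refine ⟨X ∪ {v}, ?_, ?_, ?_⟩
      · exact union_subset (hX.trans (filter_subset _ _)) (by simpa using hv)
      · refine .union hT hX1 (.singleton hT v) fun x hx y hy => ?_
        rw [mem_singleton] at hy
        subst hy
        exact (mem_filter.1 (hX hx)).2
      · rw [card_union_of_disjoint (by simpa using hv')]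
        simp; omega

/-- A vertex of maximum outdegree works: by transitivity, a vertex beating it would inherit all its
outneighbors and gain one more. -/
theorem TransOn.exists_source (hT : T.IsTournament) {X : Finset V} (hX : T.TransOn X)
    (hne : X.Nonempty) : ∃ v ∈ X, ∀ w ∈ X, w ≠ v → T.Adj v w := by
  obtain ⟨v, hv, hmax⟩ := exists_max_image X (fun v => #{w ∈ X | T.Adj v w}) hne
  refine ⟨v, hv, fun w hw hwv => ?_⟩
  by_contra h
  have hwv' := hT.adj_of_not hwv.symm h
  refine absurd (hmax w hw) (not_le.2 (card_lt_card ?_))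
  refine (ssubset_iff_of_subset ?_).2 ⟨v, by simp [hv, hwv'], by simp [hT.loopless v]⟩
  intro u hu
  rw [mem_filter] at hu ⊢
  exact ⟨hu.1, hX w hw v hv u hu.1 hwv' hu.2⟩

/-- A transitive tournament has an initial segment of every size. -/
theorem TransOn.exists_initial (hT : T.IsTournament) (k : ℕ) :
    ∀ X : Finset V, T.TransOn X → k ≤ #X →
      ∃ L ⊆ X, #L = k ∧ ∀ a ∈ L, ∀ b ∈ X \ L, T.Adj a b := by
  induction k with
  | zero => intro X _ _; exact ⟨∅, by simp, by simp, by simp⟩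
  | succ k ih =>
    intro X hX hk
    obtain ⟨v, hv, hsrc⟩ := hX.exists_source hT (card_pos.1 (by omega))
    obtain ⟨L, hL, hLc, hLa⟩ := ih (X.erase v) (hX.mono (erase_subset _ _))
      (by rw [card_erase_of_mem hv]; omega)
    have hvL : v ∉ L := fun h => by simpa using hL h
    refine ⟨insert v L, insert_subset hv (hL.trans (erase_subset _ _)), ?_, ?_⟩
    · rw [card_insert_of_notMem hvL, hLc]
    · intro a ha b hb
      simp only [mem_sdiff, mem_insert, not_or] at ha hb
      rcases ha with rfl | ha
      · exact hsrc b hb.1 hb.2.1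
      · exact hLa a ha b (by simp [hb])

/-! ### Smooth pairs and sequences of linear size. -/

/-- Double counting: if more than half of `Y` failed, there would be more than `r * #X * #Y` pairs.
-/
theorem card_filter_half_le {X Y : Finset V} {P : V → V → Prop} {r : ℝ}
    (h : ∀ x ∈ X, (#{y ∈ Y | P x y} : ℝ) ≤ r * #Y) (hr : 0 < r) :
    (#Y : ℝ) / 2 ≤ #{y ∈ Y | (#{x ∈ X | P x y} : ℝ) ≤ 2 * r * #X} := by
  rcases X.eq_empty_or_nonempty with rfl | hne
  · simp
  have hXpos : (0 : ℝ) < #X := by exact_mod_cast card_pos.2 hne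
  set B := {y ∈ Y | ¬ (#{x ∈ X | P x y} : ℝ) ≤ 2 * r * #X} with hB
  have hsum := card_filter_add_card_filter_not
    (s := Y) (fun y => (#{x ∈ X | P x y} : ℝ) ≤ 2 * r * #X)
  have hdc : ∑ x ∈ X, (#{y ∈ Y | P x y} : ℝ) = ∑ y ∈ Y, (#{x ∈ X | P x y} : ℝ) := by
    exact_mod_cast sum_card_bipartiteAbove_eq_sum_card_bipartiteBelow P
  have h1 : ∑ x ∈ X, (#{y ∈ Y | P x y} : ℝ) ≤ #X * (r * #Y) := by
    simpa using sum_le_sum h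
  have h2 : #B * (2 * r * #X) ≤ ∑ y ∈ Y, (#{x ∈ X | P x y} : ℝ) := by
    calc #B * (2 * r * #X) = ∑ y ∈ B, 2 * r * #X := by simp
      _ ≤ ∑ y ∈ B, (#{x ∈ X | P x y} : ℝ) :=
          sum_le_sum fun y hy => (not_le.1 (mem_filter.1 hy).2).le
      _ ≤ _ := sum_le_sum_of_subset_of_nonneg (filter_subset _ _) fun _ _ _ => by positivity
  have h3 : (#B : ℝ) ≤ #Y / 2 := by
    have : (r * #X) * (2 * #B) ≤ (r * #X) * #Y := by
      calc (r * #X) * (2 * #B) = #B * (2 * r * #X) := by ring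
        _ ≤ #X * (r * #Y) := by linarith
        _ = _ := by ring
    have := le_of_mul_le_mul_left this (by positivity)
    linarith
  have h4 : (#{y ∈ Y | (#{x ∈ X | P x y} : ℝ) ≤ 2 * r * #X} : ℝ) + #B = #Y := by
    exact_mod_cast hsum
  linarith

theorem Smooth.mono {r s t : ℝ} {X Y X' Y' : Finset V} (h : T.Smooth r X Y)
    (hs : r ≤ s * t) (hs0 : 0 ≤ s) (hX : X' ⊆ X) (hY : Y' ⊆ Y)
    (hXc : t * #X ≤ #X') (hYc : t * #Y ≤ #Y') : T.Smooth s X' Y' := by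
  have aux : ∀ {A A' : Finset V} {p : V → Prop}, A' ⊆ A → t * #A ≤ #A' →
      (#{a ∈ A | p a} : ℝ) ≤ r * #A → (#{a ∈ A' | p a} : ℝ) ≤ s * #A' := by
    intro A A' p hA hc hp
    calc (#{a ∈ A' | p a} : ℝ) ≤ #{a ∈ A | p a} := by
          exact_mod_cast card_le_card (filter_subset_filter _ hA)
      _ ≤ r * #A := hp
      _ ≤ s * t * #A := by gcongr
      _ = s * (t * #A) := by ring
      _ ≤ s * #A' := by gcongr
  exact ⟨disjoint_of_subset_left hX (disjoint_of_subset_right hY h.1),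
    fun x hx => aux hY hYc (h.2.1 x (hX hx)), fun y hy => aux hX hXc (h.2.2 y (hY hy))⟩

/-- Greedy embedding: either a tournament pattern `H` is found with its vertices in the prescribed
sets, or two large sets are almost complete in one direction, seen from the vertices of one. -/
theorem exists_pattern_or_sparse {r : ℝ} (hr : 0 < r) (hr1 : r ≤ 1) (k : ℕ) :
    ∃ d : ℝ, 0 < d ∧ d ≤ 1 ∧ ∀ (V : Type u) (T : Digraph V) (H : Fin k → Fin k → Prop)
      (U : Finset V) (W : Fin k → Finset V) (m : ℝ), 0 < m → (∀ i, W i ⊆ U) → (∀ i, m ≤ #(W i)) →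
      (∃ f : Fin k → V, (∀ i, f i ∈ W i) ∧ ∀ i j, i < j →
        (H i j → T.Adj (f i) (f j)) ∧ (¬ H i j → T.Adj (f j) (f i))) ∨
      ∃ X ⊆ U, ∃ Y ⊆ U, d * m ≤ #X ∧ d * m ≤ #Y ∧
        ((∀ x ∈ X, (#{y ∈ Y | T.Adj x y} : ℝ) ≤ r * #Y) ∨
          ∀ x ∈ X, (#{y ∈ Y | T.Adj y x} : ℝ) ≤ r * #Y) := by
  induction k with
  | zero =>
    exact ⟨1, one_pos, le_rfl, fun V T H U W m _ _ _ => .inl ⟨Fin.elim0, fun i => i.elim0,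
      fun i => i.elim0⟩⟩
  | succ k ih =>
    obtain ⟨d, hd, hd1, hI⟩ := ih
    -- `1 / (k + 1)` pays for a large bad set, `r * d` for recursing into sets shrunk by the factor
    -- `r`. With `k + 1` instead of `k`, small bad sets cannot cover `W 0`.
    refine ⟨min (1 / (k + 1)) (r * d), by positivity, (min_le_right _ _).trans (by nlinarith), ?_⟩
    intro V T H U W m hm hWU hWm
    have hdm1 : min (1 / (k + 1 : ℝ)) (r * d) * m ≤ m / (k + 1) := by
      calc _ ≤ 1 / (k + 1 : ℝ) * m := by gcongr; exact min_le_left _ _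
        _ = _ := by ring
    have hdm2 : min (1 / (k + 1 : ℝ)) (r * d) * m ≤ d * (r * m) := by
      calc _ ≤ (r * d) * m := by gcongr; exact min_le_right _ _
        _ = _ := by ring
    have hkm : m / (k + 1) ≤ m := div_le_self hm.le (by linarith [Nat.cast_nonneg (α := ℝ) k])
    let Q : Fin k → V → V → Prop := fun j x y =>
      (H 0 j.succ → T.Adj x y) ∧ (¬ H 0 j.succ → T.Adj y x)
    let bad : Fin k → Finset V := fun j => {x ∈ W 0 | (#{y ∈ W j.succ | Q j x y} : ℝ) < r * #(W j.succ)}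
    by_cases hb : ∃ j, m / (k + 1) ≤ #(bad j)
    · obtain ⟨j, hj⟩ := hb
      refine .inr ⟨bad j, (filter_subset _ _).trans (hWU 0), W j.succ, hWU _, hdm1.trans hj,
        (hdm1.trans hkm).trans (hWm _), ?_⟩
      by_cases hH : H 0 j.succ
      · left
        intro x hx
        simpa [Q, hH] using (mem_filter.1 hx).2.le
      · right
        intro x hx
        simpa [Q, hH] using (mem_filter.1 hx).2.le
    · push Not at hb
      have hex : ∃ x ∈ W 0, ∀ j, x ∉ bad j := by
        by_contra! hcon
        have hsub : W 0 ⊆ univ.biUnion bad := by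
          intro x hx
          obtain ⟨j, hj⟩ := hcon x hx
          exact mem_biUnion.2 ⟨j, mem_univ _, hj⟩
        have h1 : (#(W 0) : ℝ) ≤ ∑ j, (#(bad j) : ℝ) := by
          exact_mod_cast (card_le_card hsub).trans card_biUnion_le
        have h2 : ∑ j, (#(bad j) : ℝ) ≤ ∑ _j : Fin k, m / (k + 1) :=
          sum_le_sum fun j _ => (hb j).le
        have h3 : ∑ _j : Fin k, m / (k + 1 : ℝ) < m := by
          rw [sum_const, card_univ, Fintype.card_fin, nsmul_eq_mul, ← mul_div_assoc,
            div_lt_iff₀ (by positivity)]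
          nlinarith
        linarith [hWm 0]
      obtain ⟨x, hx, hxb⟩ := hex
      have hgood : ∀ j, r * m ≤ #{y ∈ W j.succ | Q j x y} := by
        intro j
        have := hxb j
        simp only [bad, mem_filter, hx, true_and, not_lt] at this
        exact (mul_le_mul_of_nonneg_left (hWm _) hr.le).trans this
      rcases hI V T (fun i j => H i.succ j.succ) U (fun j => {y ∈ W j.succ | Q j x y}) (r * m)
        (by positivity) (fun j => (filter_subset _ _).trans (hWU _)) hgood with
        ⟨f, hf, hff⟩ | ⟨X, hX, Y, hY, hXc, hYc, hXY⟩
      · left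
        refine ⟨Fin.cons x f, ?_, ?_⟩
        · intro i
          refine Fin.cases ?_ (fun j => ?_) i
          · simpa using hx
          · simpa using (mem_filter.1 (hf j)).1
        · intro i j
          refine Fin.cases ?_ (fun j => ?_) j
          · intro h; exact absurd h (Fin.not_lt_zero i)
          · refine Fin.cases ?_ (fun i => ?_) i
            · intro _
              simpa using (mem_filter.1 (hf j)).2
            · intro h
              simpa using hff i j (Fin.succ_lt_succ_iff.1 h)
      · exact .inr ⟨X, hX, Y, hY, hdm2.trans hXc, hdm2.trans hYc, hXY⟩

/-- A map into a tournament which preserves the edges of a tournament is an embedding. -/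
theorem not_isFree_of_hom {W : Type*} {H : Digraph W} (hT : T.IsTournament)
    (hH : H.IsTournament) (f : W → V) (hf : ∀ a b, H.Adj a b → T.Adj (f a) (f b)) :
    ¬ T.IsFree H := by
  have hinj : Function.Injective f := by
    intro a b hab
    by_contra hne
    rcases hH.xor_adj a b hne with h | h
    · have := hf _ _ h.1; rw [hab] at this; exact hT.loopless _ this
    · have := hf _ _ h.1; rw [hab] at this; exact hT.loopless _ this
  refine fun h => h.false ⟨⟨f, hinj⟩, fun {a b} => ⟨fun hab => ?_, hf a b⟩⟩
  by_contra hn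
  have hne : a ≠ b := by
    rintro rfl
    exact hT.loopless _ hab
  exact hT.asymm hab (hf _ _ (hH.adj_of_not hne hn))

/-- Cutting `X` to about `d / 2` vertices lets it be removed from `Y` at the cost of at most half of
`Y`; discarding the bad half of the remainder makes sparsity two-sided. Each halving doubles `r`.
The bound `2 ≤ d` absorbs the rounding. -/
theorem Smooth.of_sparse {r d : ℝ} {X Y : Finset V} {P : V → V → Prop} (hr : 0 < r) (hd : 2 ≤ d)
    (hXd : d ≤ #X) (hYd : d ≤ #Y) (h : ∀ x ∈ X, (#{y ∈ Y | P x y} : ℝ) ≤ r * #Y) :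
    ∃ X' ⊆ X, ∃ Y' ⊆ Y, d / 4 ≤ #X' ∧ d / 4 ≤ #Y' ∧ Disjoint X' Y' ∧
      (∀ x ∈ X', (#{y ∈ Y' | P x y} : ℝ) ≤ 4 * r * #Y') ∧
      ∀ y ∈ Y', (#{x ∈ X' | P x y} : ℝ) ≤ 4 * r * #X' := by
  have hfl : (⌊d / 2⌋₊ : ℝ) ≤ d / 2 := Nat.floor_le (by linarith)
  have hfl' : d / 2 < ⌊d / 2⌋₊ + 1 := Nat.lt_floor_add_one _
  have hfl1 : (1 : ℝ) ≤ ⌊d / 2⌋₊ := by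
    exact_mod_cast (Nat.one_le_floor_iff (d / 2)).2 (by linarith)
  obtain ⟨X', hX', hX'c⟩ := exists_subset_card_eq (s := X) (n := ⌊d / 2⌋₊) (by
    have : (⌊d / 2⌋₊ : ℝ) ≤ #X := by linarith
    exact_mod_cast this)
  have hX'r : (#X' : ℝ) = ⌊d / 2⌋₊ := by exact_mod_cast hX'c
  have hY1 : (#Y : ℝ) / 2 ≤ #(Y \ X') := by
    have h1 : (#Y : ℝ) ≤ #(Y \ X') + #X' := by
      exact_mod_cast (by have := le_card_sdiff X' Y; omega)
    linarith
  have hX1 : ∀ x ∈ X', (#{y ∈ Y \ X' | P x y} : ℝ) ≤ (2 * r) * #(Y \ X') := by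
    intro x hx
    calc (#{y ∈ Y \ X' | P x y} : ℝ) ≤ #{y ∈ Y | P x y} := by
          exact_mod_cast card_le_card (filter_subset_filter _ sdiff_subset)
      _ ≤ r * #Y := h x (hX' hx)
      _ ≤ _ := by nlinarith
  have hhalf := card_filter_half_le hX1 (by positivity)
  refine ⟨X', hX', {y ∈ Y \ X' | (#{x ∈ X' | P x y} : ℝ) ≤ 2 * (2 * r) * #X'},
    (filter_subset _ _).trans sdiff_subset, by linarith, by linarith, ?_, ?_, ?_⟩
  · exact disjoint_of_subset_right (filter_subset _ _) disjoint_sdiff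
  · intro x hx
    refine le_trans ?_ ((hX1 x hx).trans ?_)
    · exact_mod_cast card_le_card (filter_subset_filter _ (filter_subset _ _))
    · nlinarith
  · intro y hy
    have := (mem_filter.1 hy).2
    linarith

/-- Tournaments excluding a fixed tournament have a smooth pair of sets of linear size. -/
theorem exists_smooth_pair {k : ℕ} {W : Type*} {H : Digraph W} (hH : H.IsTournament)
    (e : Fin k ≃ W) {r : ℝ} (hr : 0 < r) (hr1 : r ≤ 1) :
    ∃ d : ℝ, 0 < d ∧ d ≤ 1 ∧ ∀ (V : Type u) (T : Digraph V), T.IsTournament → T.IsFree H →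
      ∀ U : Finset V, 1 ≤ d * #U → ∃ X ⊆ U, ∃ Y ⊆ U, d * #U ≤ #X ∧ d * #U ≤ #Y ∧
        T.Smooth r X Y := by
  obtain ⟨d, hd, hd1, hI⟩ := exists_pattern_or_sparse.{u} (r := r / 4) (by positivity)
    (by linarith) k
  refine ⟨d / 4, by positivity, by linarith, fun V T hT hfree U hU => ?_⟩
  have hUpos : (0 : ℝ) < #U := by
    by_contra h
    have : (#U : ℝ) = 0 := le_antisymm (not_lt.1 h) (Nat.cast_nonneg _)
    rw [this] at hU
    norm_num at hU
  rcases hI V T (fun i j => H.Adj (e i) (e j)) U (fun _ => U) #U hUpos (fun _ => Subset.rfl)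
    (fun _ => le_rfl) with ⟨f, -, hf⟩ | ⟨X, hX, Y, hY, hXc, hYc, h⟩
  · refine absurd hfree (not_isFree_of_hom hT hH (fun a => f (e.symm a)) fun a b hab => ?_)
    rcases lt_trichotomy (e.symm a) (e.symm b) with h | h | h
    · exact (hf _ _ h).1 (by simpa using hab)
    · rw [e.symm.injective h] at hab
      exact absurd hab (hH.loopless _)
    · exact (hf _ _ h).2 (by simpa using hH.asymm hab)
  · have h4 : 4 * (r / 4) = r := by ring
    rcases h with h | h
    · obtain ⟨X', hX', Y', hY', h1, h2, h3, h5, h6⟩ :=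
        Smooth.of_sparse (by positivity) (by linarith) hXc hYc h
      rw [h4] at h5 h6
      exact ⟨Y', hY'.trans hY, X', hX'.trans hX, by linarith, by linarith, h3.symm, h6, h5⟩
    · obtain ⟨X', hX', Y', hY', h1, h2, h3, h5, h6⟩ :=
        Smooth.of_sparse (P := fun x y => T.Adj y x) (by positivity) (by linarith) hXc hYc h
      rw [h4] at h5 h6
      exact ⟨X', hX'.trans hX, Y', hY'.trans hY, by linarith, by linarith, h3, h5, h6⟩

/-- Tournaments excluding a fixed tournament have sequences of pairwise smooth sets of linear
size. -/
theorem exists_smooth_seq {k : ℕ} {W : Type*} {H : Digraph W} (hH : H.IsTournament)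
    (e : Fin k ≃ W) {r : ℝ} (hr : 0 < r) (hr1 : r ≤ 1) (l : ℕ) :
    ∃ d : ℝ, 0 < d ∧ d ≤ 1 ∧ ∀ (V : Type u) (T : Digraph V), T.IsTournament → T.IsFree H →
      ∀ U : Finset V, 1 ≤ d * #U → ∃ A : Fin l → Finset V,
        (∀ i, A i ⊆ U) ∧ (∀ i, d * #U ≤ #(A i)) ∧ ∀ i j, i < j → T.Smooth r (A i) (A j) := by
  induction l with
  | zero =>
    exact ⟨1, one_pos, le_rfl, fun V T _ _ U _ => ⟨fun _ => ∅, fun i => i.elim0,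
      fun i => i.elim0, fun i => i.elim0⟩⟩
  | succ l ih =>
    obtain ⟨d₁, hd₁, hd₁1, h₁⟩ := ih
    -- The rest of the sequence lives inside `Y` in sets of proportion `d₁`, so density `r * d₁`
    -- towards `Y` becomes `r` towards them.
    obtain ⟨d₂, hd₂, hd₂1, h₂⟩ := exists_smooth_pair.{u} hH e (r := r * d₁) (by positivity)
      (by nlinarith)
    refine ⟨d₁ * d₂, by positivity, by nlinarith, fun V T hT hfree U hU => ?_⟩
    have hle : d₁ * d₂ * #U ≤ d₂ * #U := by
      rw [mul_assoc]
      exact mul_le_of_le_one_left (by positivity) hd₁1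
    obtain ⟨X, hX, Y, hY, hXc, hYc, hXY⟩ := h₂ V T hT hfree U (hU.trans hle)
    have hle' : d₁ * d₂ * #U ≤ d₁ * #Y := by
      rw [mul_assoc]
      gcongr
    obtain ⟨A, hA, hAc, hAs⟩ := h₁ V T hT hfree Y (hU.trans hle')
    refine ⟨Fin.cons X A, ?_, ?_, ?_⟩
    · intro i
      refine Fin.cases ?_ (fun j => ?_) i
      · simpa using hX
      · simpa using (hA j).trans hY
    · intro i
      refine Fin.cases ?_ (fun j => ?_) i
      · simpa using hle.trans hXc
      · simpa using hle'.trans (hAc j)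
    · intro i j
      refine Fin.cases ?_ (fun j => ?_) j
      · intro h; exact absurd h (Fin.not_lt_zero i)
      · refine Fin.cases ?_ (fun i => ?_) i
        · intro _
          simpa using hXY.mono (t := d₁) le_rfl hr.le Subset.rfl (hA j)
            (mul_le_of_le_one_left (by positivity) hd₁1) (hAc j)
        · intro h
          simpa using hAs i j (Fin.succ_lt_succ_iff.1 h)

/-! ### Finding `L1` in a smooth sequence. -/

theorem not_isFree_L1 (hT : T.IsTournament) {v₀ v₁ v₂ v₃ v₄ x : V}
    (h01 : T.Adj v₀ v₁) (h02 : T.Adj v₀ v₂) (h12 : T.Adj v₁ v₂) (h13 : T.Adj v₁ v₃)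
    (h23 : T.Adj v₂ v₃) (h24 : T.Adj v₂ v₄) (h34 : T.Adj v₃ v₄) (h30 : T.Adj v₃ v₀)
    (h40 : T.Adj v₄ v₀) (h41 : T.Adj v₄ v₁) (hx0 : T.Adj x v₀) (h1x : T.Adj v₁ x)
    (h2x : T.Adj v₂ x) (h3x : T.Adj v₃ x) (h4x : T.Adj v₄ x) : ¬ T.IsFree L1 := by
  refine not_isFree_of_hom hT L1_isTournament (fun o => o.elim x ![v₀, v₁, v₂, v₃, v₄]) ?_
  rintro (_ | a) (_ | b) hab
  · exact hab.elim
  · have : b = 0 := hab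
    subst this
    exact hx0
  · have : a ≠ 0 := hab
    fin_cases a
    · exact absurd rfl this
    all_goals assumption
  · have : b = a + 1 ∨ b = a + 2 := hab
    rcases this with rfl | rfl <;> fin_cases a <;> assumption

/-- Two disjoint sets with transitive subsets that are jointly too large span edges in both
directions. -/
theorem exists_adj_of_large (hT : T.IsTournament) {S : Finset V} {N : ℝ}
    (hsmall : ∀ X ⊆ S, T.TransOn X → (#X : ℝ) < N) {X Y P Q : Finset V} (hX : X ⊆ S)
    (hY : Y ⊆ S) (hXY : Disjoint X Y) (hP : P ⊆ X) (hQ : Q ⊆ Y) (hPt : T.TransOn P)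
    (hQt : T.TransOn Q) (hN : N ≤ #P + #Q) : ∃ x ∈ X, ∃ y ∈ Y, T.Adj y x := by
  by_contra! hcon
  have hPQ : Disjoint P Q := disjoint_of_subset_left hP (disjoint_of_subset_right hQ hXY)
  have hne : ∀ x ∈ X, ∀ y ∈ Y, y ≠ x := fun x hx y hy h => disjoint_left.1 hXY hx (h ▸ hy)
  have := hsmall (P ∪ Q) (union_subset (hP.trans hX) (hQ.trans hY))
    (.union hT hPt hQt fun x hx y hy =>
      hT.adj_of_not (hne x (hP hx) y (hQ hy)) (hcon x (hP hx) y (hQ hy)))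
  rw [card_union_of_disjoint hPQ] at this
  push_cast at this
  linarith

theorem not_isFree_L1_of_structure (hT : T.IsTournament) {S : Finset V} {N m : ℝ} (hm : 0 < m)
    (hN : 100 ≤ N) (hsmall : ∀ X ⊆ S, T.TransOn X → (#X : ℝ) < N)
    (hlarge : ∀ X ⊆ S, X ≠ S → m ≤ #X → ∃ P ⊆ X, T.TransOn P ∧ 7 / 8 * N ≤ #P)
    (B : Fin 6 → Finset V) (hBS : ∀ i, B i ⊆ S) (hB2 : T.TransOn (B 2))
    (hB2c : 7 / 8 * N ≤ #(B 2)) (hBc : ∀ i, i ≠ 2 → 4 * m ≤ #(B i))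
    (hB : ∀ i j, i < j → T.Smooth (1 / 20) (B i) (B j)) : ¬ T.IsFree L1 := by
  have hpos : ∀ i, (0 : ℝ) < #(B i) := by
    intro i
    by_cases hi : i = 2
    · subst hi; linarith
    · linarith [hBc i hi]
  have hdisj : ∀ i j, i ≠ j → Disjoint (B i) (B j) := by
    intro i j hij
    rcases lt_or_gt_of_ne hij with h | h
    · exact (hB i j h).1
    · exact (hB j i h).1.symm
  have hproper : ∀ i X, X ⊆ B i → X ≠ S := by
    rintro i X hX rfl
    obtain ⟨j, hj⟩ : ∃ j, i ≠ j := ⟨i + 1, by simp⟩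
    obtain ⟨v, hv⟩ := card_pos.1 (by exact_mod_cast hpos j : 0 < #(B j))
    exact disjoint_left.1 (hdisj i j hj) (hX (hBS j hv)) hv
  have hup : ∀ i j, i < j → ∀ v ∈ B i, ∀ Y ⊆ B j,
      (#Y : ℝ) - 1 / 20 * #(B j) ≤ #{w ∈ Y | T.Adj v w} := by
    intro i j hij v hv Y hY
    have h1 : #Y ≤ #{w ∈ Y | T.Adj v w} + #{w ∈ B j | T.Adj w v} := by
      refine (card_le_card ?_).trans (card_union_le _ _)
      intro w hw
      by_cases h : T.Adj v w
      · simp [hw, h]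
      · have hne : v ≠ w := fun e => disjoint_left.1 (hdisj i j hij.ne) hv (e ▸ hY hw)
        simp [hY hw, hT.adj_of_not hne h]
    have h2 := (hB i j hij).2.1 v hv
    have h3 : (#Y : ℝ) ≤ #{w ∈ Y | T.Adj v w} + #{w ∈ B j | T.Adj w v} := by exact_mod_cast h1
    linarith
  have hdown : ∀ i j, i < j → ∀ v ∈ B j, ∀ Y ⊆ B i,
      (#Y : ℝ) - 1 / 20 * #(B i) ≤ #{w ∈ Y | T.Adj w v} := by
    intro i j hij v hv Y hY
    have h1 : #Y ≤ #{w ∈ Y | T.Adj w v} + #{w ∈ B i | T.Adj v w} := by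
      refine (card_le_card ?_).trans (card_union_le _ _)
      intro w hw
      by_cases h : T.Adj w v
      · simp [hw, h]
      · have hne : w ≠ v := fun e => disjoint_left.1 (hdisj i j hij.ne) (hY hw) (e ▸ hv)
        simp [hY hw, hT.adj_of_not hne h]
    have h2 := (hB i j hij).2.2 v hv
    have h3 : (#Y : ℝ) ≤ #{w ∈ Y | T.Adj w v} + #{w ∈ B i | T.Adj v w} := by exact_mod_cast h1
    linarith
  have hback : ∀ i j, i ≠ j → ∀ X ⊆ B i, ∀ Y ⊆ B j, m ≤ #X → m ≤ #Y →
      ∃ x ∈ X, ∃ y ∈ Y, T.Adj y x := by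
    intro i j hij X hX Y hY hXm hYm
    obtain ⟨P, hP, hPt, hPc⟩ := hlarge X (hX.trans (hBS i)) (hproper i X hX) hXm
    obtain ⟨Q, hQ, hQt, hQc⟩ := hlarge Y (hY.trans (hBS j)) (hproper j Y hY) hYm
    exact exists_adj_of_large hT hsmall (hX.trans (hBS i)) (hY.trans (hBS j))
      (disjoint_of_subset_left hX (disjoint_of_subset_right hY (hdisj i j hij))) hP hQ hPt hQt
      (by linarith)
  -- A backward edge from block 3 to block 1. The sets below consist of the vertices of blocks 0, 2,
  -- 5, 4 joined to both `a` and `b` by forward edges only.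
  obtain ⟨a, ha, b, hb, hba⟩ := hback 1 3 (by decide) (B 1) Subset.rfl (B 3) Subset.rfl
    (by linarith [hBc 1 (by decide)]) (by linarith [hBc 3 (by decide)])
  set X := {w ∈ {w ∈ B 0 | T.Adj w a} | T.Adj w b} with hX
  set Y := {w ∈ {w ∈ B 2 | T.Adj a w} | T.Adj w b} with hY
  set Z := {w ∈ {w ∈ B 5 | T.Adj a w} | T.Adj b w} with hZ
  set E := {w ∈ {w ∈ B 4 | T.Adj a w} | T.Adj b w} with hE
  have hXB : X ⊆ B 0 := (filter_subset _ _).trans (filter_subset _ _)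
  have hYB : Y ⊆ B 2 := (filter_subset _ _).trans (filter_subset _ _)
  have hZB : Z ⊆ B 5 := (filter_subset _ _).trans (filter_subset _ _)
  have hEB : E ⊆ B 4 := (filter_subset _ _).trans (filter_subset _ _)
  have hXc : 9 / 10 * (#(B 0) : ℝ) ≤ #X := by
    linarith [hdown 0 1 (by decide) a ha (B 0) Subset.rfl,
      hdown 0 3 (by decide) b hb {w ∈ B 0 | T.Adj w a} (filter_subset _ _)]
  have hYc : 9 / 10 * (#(B 2) : ℝ) ≤ #Y := by
    linarith [hup 1 2 (by decide) a ha (B 2) Subset.rfl,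
      hdown 2 3 (by decide) b hb {w ∈ B 2 | T.Adj a w} (filter_subset _ _)]
  have hZc : 9 / 10 * (#(B 5) : ℝ) ≤ #Z := by
    linarith [hup 1 5 (by decide) a ha (B 5) Subset.rfl,
      hup 3 5 (by decide) b hb {w ∈ B 5 | T.Adj a w} (filter_subset _ _)]
  have hEc : 9 / 10 * (#(B 4) : ℝ) ≤ #E := by
    linarith [hup 1 4 (by decide) a ha (B 4) Subset.rfl,
      hup 3 4 (by decide) b hb {w ∈ B 4 | T.Adj a w} (filter_subset _ _)]
  -- Three pairwise backward edges on `x`, `y`, `z` complete `a`, `b` to a copy of `C5`.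
  by_cases htri : ∃ x ∈ X, ∃ y ∈ Y, ∃ z ∈ Z, T.Adj y x ∧ T.Adj z y ∧ T.Adj z x
  · obtain ⟨x, hx, y, hy, z, hz, hyx, hzy, hzx⟩ := htri
    obtain ⟨e, he⟩ : {w ∈ {w ∈ {w ∈ E | T.Adj x w} | T.Adj y w} | T.Adj w z}.Nonempty := by
      rw [← card_pos]
      have h1 := hup 0 4 (by decide) x (hXB hx) E hEB
      have h2 := hup 2 4 (by decide) y (hYB hy) {w ∈ E | T.Adj x w} ((filter_subset _ _).trans hEB)
      have h3 := hdown 4 5 (by decide) z (hZB hz) {w ∈ {w ∈ E | T.Adj x w} | T.Adj y w}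
        ((filter_subset _ _).trans ((filter_subset _ _).trans hEB))
      have h4 := hpos 4
      exact_mod_cast (by linarith :
        (0 : ℝ) < #{w ∈ {w ∈ {w ∈ E | T.Adj x w} | T.Adj y w} | T.Adj w z})
    simp only [hX, hY, hZ, hE, mem_filter] at hx hy hz he
    obtain ⟨⟨-, hxa⟩, hxb⟩ := hx
    obtain ⟨⟨-, hay⟩, hyb⟩ := hy
    obtain ⟨⟨-, haz⟩, hbz⟩ := hz
    obtain ⟨⟨⟨⟨⟨-, hae⟩, hbe⟩, hxe⟩, hye⟩, hez⟩ := he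
    exact not_isFree_L1 hT (v₀ := z) (v₁ := y) (v₂ := x) (v₃ := b) (v₄ := a) (x := e)
      hzy hzx hyx hyb hxb hxa hba hbz haz hay hez hye hxe hbe hae
  -- Otherwise `Y` is split into consecutive pieces `L`, `M`, `R`. For a backward edge `z → x`, the
  -- absence of backward triangles forces `p → z` if `p → x`, and `x → l` if `z → l`. With `p` in
  -- `R`, `l` in `L` and a typical `c` in `M`, this is `C5`.
  · push Not at htri
    have hYt : T.TransOn Y := hB2.mono hYB
    obtain ⟨L, hLY, hLc, hL⟩ := hYt.exists_initial hT (#Y / 3) Y (by omega)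
    obtain ⟨M, hMY, hMc, hM⟩ := TransOn.exists_initial hT (#Y / 3) (Y \ L)
      (hYt.mono sdiff_subset) (by rw [card_sdiff_of_subset hLY]; omega)
    set R := (Y \ L) \ M with hR
    have hRY : R ⊆ Y := sdiff_subset.trans sdiff_subset
    have hMY' : M ⊆ Y := hMY.trans sdiff_subset
    have hRc : #Y / 3 ≤ #R := by
      rw [hR, card_sdiff_of_subset hMY, card_sdiff_of_subset hLY]
      omega
    -- A third of `9/10`, less rounding; `#(B 2)` is large since `N ≥ 100`.
    have hq : 1 / 4 * (#(B 2) : ℝ) ≤ (#Y / 3 : ℕ) := by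
      have : (#Y : ℝ) ≤ 3 * (#Y / 3 : ℕ) + 2 := by exact_mod_cast (by omega)
      linarith
    have hLc' : 1 / 4 * (#(B 2) : ℝ) ≤ #L := by rw [hLc]; exact hq
    have hMc' : 1 / 4 * (#(B 2) : ℝ) ≤ #M := by rw [hMc]; exact hq
    have hRc' : 1 / 4 * (#(B 2) : ℝ) ≤ #R := hq.trans (by exact_mod_cast hRc)
    -- Otherwise the remaining vertices of `X` contain a transitive set of size `7N/8` complete to
    -- `R`, and `7/8 + 7/32 > 1`. The bound for `Z` and `L` is symmetric.
    have hX' : m ≤ #{x ∈ X | ∃ y ∈ R, T.Adj y x} := by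
      by_contra! hlt
      have hsum : (#{x ∈ X | ∃ y ∈ R, T.Adj y x} : ℝ) + #{x ∈ X | ¬ ∃ y ∈ R, T.Adj y x} = #X := by
        exact_mod_cast card_filter_add_card_filter_not (s := X) (fun x => ∃ y ∈ R, T.Adj y x)
      have hsub : {x ∈ X | ¬ ∃ y ∈ R, T.Adj y x} ⊆ B 0 := (filter_subset _ _).trans hXB
      obtain ⟨P, hP, hPt, hPc⟩ := hlarge _ (hsub.trans (hBS 0)) (hproper 0 _ hsub)
        (by linarith [hBc 0 (by decide)])
      obtain ⟨x, hx, y, hy, hyx⟩ := exists_adj_of_large hT hsmall (hsub.trans (hBS 0))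
        ((hRY.trans hYB).trans (hBS 2)) (disjoint_of_subset_left hsub
          (disjoint_of_subset_right (hRY.trans hYB) (hdisj 0 2 (by decide)))) hP Subset.rfl hPt
        (hYt.mono hRY) (by linarith)
      exact (mem_filter.1 hx).2 ⟨y, hy, hyx⟩
    have hZ' : m ≤ #{z ∈ Z | ∃ y ∈ L, T.Adj z y} := by
      by_contra! hlt
      have hsum : (#{z ∈ Z | ∃ y ∈ L, T.Adj z y} : ℝ) + #{z ∈ Z | ¬ ∃ y ∈ L, T.Adj z y} = #Z := by
        exact_mod_cast card_filter_add_card_filter_not (s := Z) (fun z => ∃ y ∈ L, T.Adj z y)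
      have hsub : {z ∈ Z | ¬ ∃ y ∈ L, T.Adj z y} ⊆ B 5 := (filter_subset _ _).trans hZB
      obtain ⟨P, hP, hPt, hPc⟩ := hlarge _ (hsub.trans (hBS 5)) (hproper 5 _ hsub)
        (by linarith [hBc 5 (by decide)])
      obtain ⟨y, hy, z, hz, hzy⟩ := exists_adj_of_large hT hsmall
        ((hLY.trans hYB).trans (hBS 2)) (hsub.trans (hBS 5)) (disjoint_of_subset_right hsub
          (disjoint_of_subset_left (hLY.trans hYB) (hdisj 2 5 (by decide)))) Subset.rfl hP
        (hYt.mono hLY) hPt (by linarith)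
      exact (mem_filter.1 hz).2 ⟨y, hy, hzy⟩
    obtain ⟨x, hx, z, hz, hzx⟩ := hback 0 5 (by decide) _ ((filter_subset _ _).trans hXB) _
      ((filter_subset _ _).trans hZB) hX' hZ'
    obtain ⟨hxX, p, hpR, hpx⟩ := mem_filter.1 hx
    obtain ⟨hzZ, l, hlL, hzl⟩ := mem_filter.1 hz
    have hpY := hRY hpR
    have hlY := hLY hlL
    have hne : ∀ i j, i ≠ j → ∀ v ∈ B i, ∀ w ∈ B j, v ≠ w :=
      fun i j hij v hv w hw h => disjoint_left.1 (hdisj i j hij) hv (h ▸ hw)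
    have hpz : T.Adj p z := hT.adj_of_not (hne 5 2 (by decide) z (hZB hzZ) p (hYB hpY))
      fun h => htri x hxX p hpY z hzZ hpx h hzx
    have hxl : T.Adj x l := hT.adj_of_not (hne 2 0 (by decide) l (hYB hlY) x (hXB hxX))
      fun h => htri x hxX l hlY z hzZ h hzl hzx
    obtain ⟨c, hc⟩ : {w ∈ {w ∈ M | T.Adj x w} | T.Adj w z}.Nonempty := by
      rw [← card_pos]
      have h1 := hup 0 2 (by decide) x (hXB hxX) M (hMY'.trans hYB)
      have h2 := hdown 2 5 (by decide) z (hZB hzZ) {w ∈ M | T.Adj x w}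
        ((filter_subset _ _).trans (hMY'.trans hYB))
      have h4 := hpos 2
      exact_mod_cast (by linarith : (0 : ℝ) < #{w ∈ {w ∈ M | T.Adj x w} | T.Adj w z})
    simp only [mem_filter] at hc
    obtain ⟨⟨hcM, hxc⟩, hcz⟩ := hc
    have hcB := hYB (hMY' hcM)
    obtain ⟨e, he⟩ : {w ∈ {w ∈ {w ∈ {w ∈ {w ∈ B 4 | T.Adj x w} | T.Adj l w} | T.Adj c w} |
        T.Adj p w} | T.Adj w z}.Nonempty := by
      rw [← card_pos]
      have h1 := hup 0 4 (by decide) x (hXB hxX) (B 4) Subset.rfl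
      have s1 : {w ∈ B 4 | T.Adj x w} ⊆ B 4 := filter_subset _ _
      have h2 := hup 2 4 (by decide) l (hYB hlY) _ s1
      have s2 := (filter_subset (fun w => T.Adj l w) _).trans s1
      have h3 := hup 2 4 (by decide) c hcB _ s2
      have s3 := (filter_subset (fun w => T.Adj c w) _).trans s2
      have h4 := hup 2 4 (by decide) p (hYB hpY) _ s3
      have s4 := (filter_subset (fun w => T.Adj p w) _).trans s3
      have h5 := hdown 4 5 (by decide) z (hZB hzZ) _ s4
      have h6 := hpos 4
      exact_mod_cast (by linarith : (0 : ℝ) < #{w ∈ {w ∈ {w ∈ {w ∈ {w ∈ B 4 | T.Adj x w} |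
        T.Adj l w} | T.Adj c w} | T.Adj p w} | T.Adj w z})
    simp only [mem_filter] at he
    obtain ⟨⟨⟨⟨⟨-, hxe⟩, hle⟩, hce⟩, hpe⟩, hez⟩ := he
    have hlc : T.Adj l c := hL l hlL c (hMY hcM)
    have hlp : T.Adj l p := hL l hlL p (sdiff_subset hpR)
    have hcp : T.Adj c p := hM c hcM p hpR
    exact not_isFree_L1 hT (v₀ := z) (v₁ := x) (v₂ := l) (v₃ := c) (v₄ := p) (x := e)
      hzx hzl hxl hxc hlc hlp hcp hcz hpz hpx hez hxe hle hce hpe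

/-- The transitive set `P` in `A 2` may be sublinear, so smoothness towards it is not inherited.
Each vertex of `P` still sees few backward edges to every other `A j`, so half of `A j` sees few to
`P`. Keeping that half doubles `1 / 40` to `1 / 20`. -/
theorem not_isFree_L1_of_smooth_seq (hT : T.IsTournament) {S : Finset V} {N m : ℝ} (hm : 0 < m)
    (hN : 100 ≤ N) (hsmall : ∀ X ⊆ S, T.TransOn X → (#X : ℝ) < N)
    (hlarge : ∀ X ⊆ S, X ≠ S → m ≤ #X → ∃ P ⊆ X, T.TransOn P ∧ 7 / 8 * N ≤ #P)
    (A : Fin 6 → Finset V) (hAS : ∀ i, A i ⊆ S) (hAc : ∀ i, 8 * m ≤ #(A i))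
    (hA : ∀ i j, i < j → T.Smooth (1 / 40) (A i) (A j)) : ¬ T.IsFree L1 := by
  have hne : A 2 ≠ S := by
    intro h
    obtain ⟨v, hv⟩ := card_pos.1 (by exact_mod_cast (by linarith [hAc 0] : (0 : ℝ) < #(A 0)))
    exact disjoint_left.1 (hA 0 2 (by decide)).1 hv (h ▸ hAS 0 hv)
  obtain ⟨P, hP, hPt, hPc⟩ := hlarge (A 2) (hAS 2) hne (by linarith [hAc 2])
  -- `Q j x y` says that the edge between `x` in `P` and `y` in `A j` is backward.
  obtain ⟨Q, hQlt, hQgt⟩ : ∃ Q : Fin 6 → V → V → Prop, (∀ j, j < 2 → Q j = fun x y => T.Adj x y) ∧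
      ∀ j, 2 < j → Q j = fun x y => T.Adj y x :=
    ⟨fun j x y => if j < 2 then T.Adj x y else T.Adj y x, fun j hj => by simp only [if_pos hj],
      fun j hj => by simp only [if_neg hj.not_gt]⟩
  have hQ : ∀ j, j ≠ 2 → ∀ x ∈ P, (#{y ∈ A j | Q j x y} : ℝ) ≤ 1 / 40 * #(A j) := by
    intro j hj x hx
    rcases lt_or_gt_of_ne hj with h | h
    · simpa only [hQlt j h] using (hA j 2 h).2.2 x (hP hx)
    · simpa only [hQgt j h] using (hA 2 j h).2.1 x (hP hx)
  let B : Fin 6 → Finset V := fun j =>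
    if j = 2 then P else {y ∈ A j | (#{x ∈ P | Q j x y} : ℝ) ≤ 2 * (1 / 40) * #P}
  have hB2 : B 2 = P := if_pos rfl
  have hBj : ∀ j, j ≠ 2 → B j = {y ∈ A j | (#{x ∈ P | Q j x y} : ℝ) ≤ 2 * (1 / 40) * #P} :=
    fun j hj => if_neg hj
  have hBA : ∀ j, B j ⊆ A j := by
    intro j
    by_cases hj : j = 2
    · subst hj; rw [hB2]; exact hP
    · rw [hBj j hj]; exact filter_subset _ _
  have hhalf : ∀ j, j ≠ 2 → (#(A j) : ℝ) / 2 ≤ #(B j) := by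
    intro j hj
    rw [hBj j hj]
    exact card_filter_half_le (P := Q j) (hQ j hj) (by norm_num)
  have hside : ∀ {A' B' : Finset V} {p : V → Prop}, B' ⊆ A' → (#A' : ℝ) / 2 ≤ #B' →
      (#{y ∈ A' | p y} : ℝ) ≤ 1 / 40 * #A' → (#{y ∈ B' | p y} : ℝ) ≤ 1 / 20 * #B' := by
    intro A' B' p hsub hc hp
    have : (#{y ∈ B' | p y} : ℝ) ≤ #{y ∈ A' | p y} := by
      exact_mod_cast card_le_card (filter_subset_filter _ hsub)
    linarith
  refine not_isFree_L1_of_structure hT hm hN hsmall hlarge B (fun i => (hBA i).trans (hAS i))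
    (by rw [hB2]; exact hPt) (by rw [hB2]; exact hPc)
    (fun i hi => by linarith [hhalf i hi, hAc i]) fun i j hij => ?_
  refine ⟨disjoint_of_subset_left (hBA i) (disjoint_of_subset_right (hBA j) (hA i j hij).1),
    fun x hx => ?_, fun y hy => ?_⟩
  · by_cases hj : j = 2
    · subst hj
      rw [hBj i hij.ne] at hx
      have := (mem_filter.1 hx).2
      simp only [hQlt i hij] at this
      rw [hB2]
      linarith
    · exact hside (hBA j) (hhalf j hj) ((hA i j hij).2.1 x (hBA i hx))
  · by_cases hi : i = 2
    · subst hi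
      rw [hBj j hij.ne'] at hy
      have := (mem_filter.1 hy).2
      simp only [hQgt j hij] at this
      rw [hB2]
      linarith
    · exact hside (hBA i) (hhalf i hi) ((hA i j hij).2.2 y (hBA j hy))

/-! ### Choice of `ε` and induction. -/

theorem L1_hasErdosHajnalProperty : L1.HasErdosHajnalProperty := by
  obtain ⟨d, hd, hd1, hseq⟩ := exists_smooth_seq.{0} L1_isTournament (finSuccEquiv 5)
    (r := 1 / 40) (by norm_num) (by norm_num) 6
  -- `2 ^ 100` forces `N ≥ 100`; `1 / d` makes the smooth sequence available.
  set n₀ : ℝ := max (2 ^ 100) (1 / d) with hn₀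
  have hn₀pos : 0 < n₀ := lt_of_lt_of_le (by positivity) (le_max_left _ _)
  have hlim : ∀ a : ℝ, 0 < a →
      Filter.Tendsto (fun ε : ℝ => a ^ ε) (nhdsWithin 0 (Set.Ioi 0)) (nhds 1) := by
    intro a ha
    have h := (Real.continuousAt_const_rpow (a := a) (b := 0) ha.ne').tendsto
    rw [Real.rpow_zero] at h
    exact h.mono_left nhdsWithin_le_nhds
  -- `(d / 8) ^ ε > 7 / 8` gives the loss in linear subsets; `n₀ ^ ε < 2` lets any two vertices
  -- settle sets of size at most `n₀`.
  obtain ⟨ε, ⟨h1, h2⟩, hε⟩ := ((((hlim (d / 8) (by positivity)).eventually_const_lt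
    (by norm_num : (7 / 8 : ℝ) < 1)).and ((hlim n₀ hn₀pos).eventually_lt_const
    (by norm_num : (1 : ℝ) < 2))).and self_mem_nhdsWithin).exists
  replace hε : 0 < ε := hε
  refine ⟨ε, hε, fun V _ T hT hfree => ?_⟩
  suffices h : ∀ S : Finset V, ∃ X ⊆ S, T.TransOn X ∧ (#S : ℝ) ^ ε ≤ #X by
    obtain ⟨X, -, hXt, hXc⟩ := h univ
    exact ⟨X, hXt.isTransitiveOn hT, by simpa using hXc⟩
  intro S
  induction S using Finset.strongInduction with
  | H S ih =>
    rcases lt_or_ge #S 2 with hS | hS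
    · refine ⟨S, Subset.rfl, fun a ha b hb c hc hab _ => ?_, ?_⟩
      · rw [card_le_one.1 (by omega : #S ≤ 1) a ha b hb] at hab
        exact absurd hab (hT.loopless b)
      · interval_cases h : #S
        · simp [Real.zero_rpow hε.ne']
        · simp
    rcases le_or_gt (#S : ℝ) n₀ with hS' | hS'
    · obtain ⟨X, hX, hXt, hXc⟩ := hT.exists_transOn_of_two_pow_le 1 S hS
      refine ⟨X, hX, hXt, ?_⟩
      have : (2 : ℝ) ≤ #X := by exact_mod_cast hXc
      linarith [Real.rpow_le_rpow (Nat.cast_nonneg _) hS' hε.le]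
    by_contra! hsmall
    obtain ⟨X, hX, hXt, hXc⟩ := hT.exists_transOn_of_two_pow_le 100 S (by
      exact_mod_cast (le_max_left (2 ^ 100 : ℝ) (1 / d)).trans hS'.le)
    have hXN := hsmall X hX hXt
    have hXc' : (101 : ℝ) ≤ #X := by exact_mod_cast hXc
    have hSpos : (0 : ℝ) < #S := hn₀pos.trans hS'
    obtain ⟨A, hAS, hAc, hA⟩ := hseq V T hT hfree S (by
      have := (le_max_right (2 ^ 100 : ℝ) (1 / d)).trans hS'.le
      rwa [div_le_iff₀ hd, mul_comm] at this)
    refine not_isFree_L1_of_smooth_seq hT (m := d / 8 * #S) (by positivity)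
      (by linarith) hsmall ?_ A hAS (fun i => by linarith [hAc i]) hA hfree
    intro Y hY hne hYc
    obtain ⟨P, hP, hPt, hPc⟩ := ih Y (Finset.ssubset_iff_subset_ne.2 ⟨hY, hne⟩)
    refine ⟨P, hP, hPt, ?_⟩
    calc 7 / 8 * (#S : ℝ) ^ ε ≤ (d / 8) ^ ε * (#S : ℝ) ^ ε := by gcongr
      _ = (d / 8 * #S) ^ ε := (Real.mul_rpow (by positivity) (by positivity)).symm
      _ ≤ (#Y : ℝ) ^ ε := by gcongr
      _ ≤ #P := hPc

end

end Digraph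

theorem mainTheorem3 : Digraph.L1.HasErdosHajnalProperty := by
  exact Digraph.L1_hasErdosHajnalProperty
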